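/- Let $p,q,c\in\mathbb C\setminus\{0\}$ with $|p|<1$, $|q|<1$, fix a fourth root $q^{1/4}$ of $q$, and interpret all powers of $q$ with exponents in $\frac14\mathbb Z$ through it. Write $$\theta(x;p)=\prod_{j\ge0}(1-p^jx)(1-p^{j+1}/x),\qquad (a;q,p)_k=\prod_{i=0}^{k-1}\theta(aq^i;p),$$ $$\theta(x_1,\dots,x_m;p)=\prod_i\theta(x_i;p),\qquad (a_1,\dots,a_m;q,p)_k=\prod_i(a_i;q,p)_k.$$ For $n\ge0$ let $W_c^n$ be the $\mathbb C$-linear span of all functions $g_k(z)/(cz,c/z;q,p)_k$, $0\le k\le n$, where $g_k$ runs over the functions holomorphic on $z\ne0$ with $g_k(z)=g_k(1/z)$ and $g_k(pz)=p^{-k}z^{-2k}g_k(z)$. Define $$\mathcal D_{c,q,p}f(z)=2q^{1/2}z\,\frac{\theta(czq^{-1/2},czq^{1/2},cq^{-1/2}/z,cq^{1/2}/z;p)}{\theta(q,z^2;p)}\bigl(f(q^{1/2}z)-f(q^{-1/2}z)\bigr),$$ $\mathcal D^{(0)}_{c,q,p}f=f$ and $\mathcal D^{(k)}_{c,q,p}=\mathcal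 D^{(k-1)}_{cq^{3/2},q,p}\,\mathcal D_{c,q,p}$ for $k\ge1$. **Theorem.** Assume that $(q;q,p)_k\ne0$ and $\bigl(cq^{\frac k2-\frac34};q^{1/2},p\bigr)_{2k}\neq0$ for $1\le k\le n$. If $f\in W_c^n$, then for every $0\le k\le n$ the meromorphic function $\mathcal D^{(k)}_{c,q,p}f$ has a finite value at $z=q^{1/4}$ (removable singularities being removed, i.e. the value is the limit as $z\to q^{1/4}$, $z\neq q^{1/4}$), and $$f(z)=\sum_{k=0}^n f_k\,\frac{(q^{1/4}z,q^{1/4}/z;q^{1/2},p)_k}{(cz,c/z;q,p)_k}$$ for all $z\ne0$ with $(cz,c/z;q,p)_n\ne0$, where $$f_k=\frac{(-1)^kq^{-k/4}\,\theta(q;p)^k}{2^k\,(q;q,p)_k\,\bigl(cq^{\frac k2-\frac34};q^{1/2},p\bigr)_{2k}}\Bigl[\mathcal D^{(k)}_{c,q,p}f(z)\Bigr]_{z=q^{1/4}}.$$ -/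

import Mathlib

open Filter Topology

noncomputable section

/-- The modified Jacobi theta function
`θ(x; p) = ∏_{j ≥ 0} (1 - p^j x) (1 - p^(j+1) / x)`, used for `x ≠ 0` and `|p| < 1`. -/
def modTheta (x p : ℂ) : ℂ :=
  ∏' j : ℕ, ((1 - p ^ j * x) * (1 - p ^ (j + 1) / x))

/-- The theta shifted factorial `(a; q, p)_n = ∏_{k < n} θ(a q^k; p)` of nonnegative index. -/
def thetaFactorial (a q p : ℂ) (n : ℕ) : ℂ :=
  ∏ k ∈ Finset.range n, modTheta (a * q ^ k) p

/-- `(c z, c / z; q, p)_n = (c z; q, p)_n (c / z; q, p)_n`. -/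
def thetaFactorialPair (c q p : ℂ) (n : ℕ) (z : ℂ) : ℂ :=
  thetaFactorial (c * z) q p n * thetaFactorial (c / z) q p n

/-- `g` is holomorphic on `z ≠ 0`, `g (1 / z) = g z` and `g (p z) = g z / (p^k z^(2k))`:
an even theta function of order `2k` and zero characteristic.
The value of `g` at `0` plays no role. -/
structure IsEvenTheta (p : ℂ) (k : ℕ) (g : ℂ → ℂ) : Prop where
  holomorphic : DifferentiableOn ℂ g {0}ᶜ
  symm : ∀ z : ℂ, z ≠ 0 → g z = g (1 / z)
  quasiperiodic : ∀ z : ℂ, z ≠ 0 → g (p * z) = 1 / (p ^ k * z ^ (2 * k)) * g z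

/-- The space `W_c^n`: the complex span of the functions `g_k(z) / (c z, c / z; q, p)_k` with
`0 ≤ k ≤ n`, where `g_k` runs over all even theta functions of order `2k`. -/
def abelianSpace (c q p : ℂ) (n : ℕ) : Submodule ℂ (ℂ → ℂ) :=
  Submodule.span ℂ {h | ∃ k ≤ n, ∃ g : ℂ → ℂ, IsEvenTheta p k g ∧
    h = fun z => g z / thetaFactorialPair c q p k z}

/-- The elliptic Askey-Wilson operator `D_{c,q,p}`, where `s` is the chosen square root of
the base, `q = s^2`. -/
def ellipticAW (c s p : ℂ) (f : ℂ → ℂ) (z : ℂ) : ℂ :=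
  2 * s * z *
    ((modTheta (c * z / s) p * modTheta (c * z * s) p *
        modTheta (c / s / z) p * modTheta (c * s / z) p) /
      (modTheta (s ^ 2) p * modTheta (z ^ 2) p)) *
    (f (s * z) - f (z / s))

/-- The iterates `D^(0) = id` and `D_{c,q,p}^(k+1) = D_{c q^(3/2),q,p}^(k) D_{c,q,p}`,
with `q^(1/2) = s`. -/
def ellipticAWIter (s p : ℂ) : ℕ → ℂ → (ℂ → ℂ) → (ℂ → ℂ)
  | 0, _, f => f
  | k + 1, c, f => ellipticAWIter s p k (c * s ^ 3) (ellipticAW c s p f)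

/-- The factor
`(-1)^k q^(-k/4) θ(q; p)^k / (2^k (q; q, p)_k (c q^(k/2 - 3/4); q^(1/2), p)_{2k})`,
where `r` is the chosen fourth root of `q`. -/
def quadraticTaylorFactor (c q r p : ℂ) (k : ℕ) : ℂ :=
  (-1) ^ k * r ^ (-(k : ℤ)) * modTheta q p ^ k /
    (2 ^ k * thetaFactorial q q p k *
      thetaFactorial (c * r ^ (2 * (k : ℤ) - 3)) (r ^ 2) p (2 * k))

end

/-! Write r = q^{1/4}. The quadratic basis functions behave like monomials for Taylor expansion. The
Askey–Wilson operator lowers the index of each by one up to a scalar, with c replaced by cq^{3/2}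
(`ellipticAW_quadraticBasis`). At z = r every one of positive index vanishes, because its numerator
contains θ(r/z), so evaluating the k-th iterate at r isolates the k-th coefficient
(`tendsto_ellipticAWIter`). The accumulated scalar is exactly the inverse of the Taylor factor.

It remains to see that the expansion exists. Over a common denominator it concerns n + 1 even theta
functions of order 2n. These are independent, since the same evaluation recovers their coefficients.
They span, since such functions form a space of dimension at most n + 1
(`IsEvenTheta.exists_eq_sum`): quasiperiodicity and symmetry determine all Laurent coefficients from
those of index 0, …, n. The case n = 1 of this bound also gives Weierstrass' addition formula, on
which the lowering relation rests.

Operator identities are only claimed off a discrete set, where no denominator vanishes; this is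
enough for punctured limits. -/

/-- The infinite shifted factorial `(x; p)_∞ = ∏_{j ≥ 0} (1 - p^j x)`. -/
noncomputable def pochhammerInf (p x : ℂ) : ℂ := ∏' j : ℕ, (1 - p ^ j * x)

/-! ### Infinite products and functional equations of θ. -/

section Theta

variable {p : ℂ}

lemma summable_norm_neg_pow_mul (hp1 : ‖p‖ < 1) (x : ℂ) :
    Summable fun j : ℕ => ‖-(p ^ j * x)‖ := by
  simpa using (summable_geometric_of_lt_one (norm_nonneg p) hp1).mul_right ‖x‖

lemma multipliable_one_sub_pow_mul (hp1 : ‖p‖ < 1) (x : ℂ) :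
    Multipliable fun j : ℕ => 1 - p ^ j * x := by
  simpa only [sub_eq_add_neg] using
    multipliable_one_add_of_summable (summable_norm_neg_pow_mul hp1 x)

lemma pochhammerInf_eq (hp1 : ‖p‖ < 1) (x : ℂ) :
    pochhammerInf p x = (1 - x) * pochhammerInf p (p * x) := by
  unfold pochhammerInf
  have h : ∀ j : ℕ, 1 - p ^ (j + 1) * x = 1 - p ^ j * (p * x) := fun j => by ring
  have hm : Multipliable fun j : ℕ => 1 - p ^ (j + 1) * x := by
    simpa only [h] using multipliable_one_sub_pow_mul hp1 (p * x)
  rw [tprod_eq_zero_mul' (f := fun j : ℕ => 1 - p ^ j * x) hm]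
  simp [h]

lemma pochhammerInf_ne_zero (hp1 : ‖p‖ < 1) {x : ℂ} (hx : ‖x‖ < 1) :
    pochhammerInf p x ≠ 0 := by
  have h := tprod_one_add_ne_zero_of_summable (f := fun j : ℕ => -(p ^ j * x)) (fun j h0 => ?_)
    (summable_norm_neg_pow_mul hp1 x)
  · simpa only [pochhammerInf, sub_eq_add_neg] using h
  · have h1 : p ^ j * x = 1 := by linear_combination -h0
    have h2 : ‖p ^ j * x‖ ≤ 1 * ‖x‖ := by
      rw [norm_mul, norm_pow]
      gcongr
      exact pow_le_one₀ (norm_nonneg _) hp1.le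
    rw [h1] at h2
    simp at h2
    linarith

lemma differentiable_pochhammerInf (hp1 : ‖p‖ < 1) : Differentiable ℂ (pochhammerInf p) := by
  have key : HasProdLocallyUniformlyOn (fun (j : ℕ) (x : ℂ) => 1 + -(p ^ j * x))
      (fun x => ∏' j : ℕ, (1 + -(p ^ j * x))) Set.univ := by
    refine hasProdLocallyUniformlyOn_of_forall_compact isOpen_univ fun K _ hK => ?_
    obtain ⟨B, hB⟩ := hK.isBounded.exists_norm_le
    refine ((summable_geometric_of_lt_one (norm_nonneg p) hp1).mul_right
      B).hasProdUniformlyOn_nat_one_add hK (.of_forall fun j x hx => ?_) (fun _ => by fun_prop)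
    rw [norm_neg, norm_mul, norm_pow]
    exact mul_le_mul_of_nonneg_left (hB x hx) (by positivity)
  have h := key.differentiableOn (.of_forall fun s => by
    simpa [Finset.prod_fn] using DifferentiableOn.finsetProd (fun _ _ => by fun_prop)) isOpen_univ
  rw [differentiableOn_univ] at h
  rwa [show pochhammerInf p = fun x => ∏' j : ℕ, (1 + -(p ^ j * x)) from
    funext fun x => by simp only [pochhammerInf, sub_eq_add_neg]]

lemma modTheta_eq_mul (hp1 : ‖p‖ < 1) (x : ℂ) :
    modTheta x p = pochhammerInf p x * pochhammerInf p (p / x) := by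
  unfold modTheta pochhammerInf
  rw [← (multipliable_one_sub_pow_mul hp1 x).tprod_mul (multipliable_one_sub_pow_mul hp1 (p / x))]
  exact tprod_congr fun j => by ring

lemma modTheta_mul_left (hp0 : p ≠ 0) (hp1 : ‖p‖ < 1) {x : ℂ} (hx : x ≠ 0) :
    modTheta (p * x) p = -modTheta x p / x := by
  rw [modTheta_eq_mul hp1, modTheta_eq_mul hp1, pochhammerInf_eq hp1 x,
    show p / (p * x) = 1 / x by field_simp, pochhammerInf_eq hp1 (1 / x),
    show p * (1 / x) = p / x by ring]
  field_simp
  ring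

lemma modTheta_inv (hp1 : ‖p‖ < 1) {x : ℂ} (hx : x ≠ 0) :
    modTheta (1 / x) p = -modTheta x p / x := by
  rw [modTheta_eq_mul hp1, modTheta_eq_mul hp1, pochhammerInf_eq hp1 x,
    show p / (1 / x) = p * x by field_simp, pochhammerInf_eq hp1 (1 / x),
    show p * (1 / x) = p / x by ring]
  field_simp
  ring

lemma modTheta_one (hp1 : ‖p‖ < 1) : modTheta 1 p = 0 := by
  rw [modTheta_eq_mul hp1, pochhammerInf_eq hp1 1]
  simp

lemma differentiableAt_modTheta (hp1 : ‖p‖ < 1) {x : ℂ} (hx : x ≠ 0) :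
    DifferentiableAt ℂ (fun x => modTheta x p) x := by
  simp only [modTheta_eq_mul hp1]
  exact (differentiable_pochhammerInf hp1 x).mul
    ((differentiable_pochhammerInf hp1 _).comp x ((differentiableAt_const p).div
      differentiableAt_id hx))

/-- For |p| < t < 1 both t and p/t lie in the unit disc, where the infinite products have no zeros.
The point serves as the witness for the identity theorem. -/
lemma exists_modTheta_ne_zero (hp1 : ‖p‖ < 1) :
    ∃ x : ℂ, x ≠ 0 ∧ modTheta x p ≠ 0 := by
  obtain ⟨t, ht1, ht2⟩ := exists_between hp1
  have ht : 0 < t := (norm_nonneg p).trans_lt ht1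
  refine ⟨t, by exact_mod_cast ht.ne', ?_⟩
  rw [modTheta_eq_mul hp1]
  refine mul_ne_zero (pochhammerInf_ne_zero hp1 ?_) (pochhammerInf_ne_zero hp1 ?_)
  · simpa [abs_of_pos ht] using ht2
  · rw [norm_div, Complex.norm_real, Real.norm_of_nonneg ht.le]
    exact (div_lt_one ht).2 ht1

end Theta

/-! ### Identities off a discrete set. -/

/-- `P` holds at every nonzero complex number off a set which is discrete and closed in
`ℂ ∖ {0}`. -/
def NearlyEverywhere (P : ℂ → Prop) : Prop := ∀ w : ℂ, w ≠ 0 → ∀ᶠ z in 𝓝[≠] w, P z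

namespace NearlyEverywhere

variable {P Q : ℂ → Prop}

lemma of_forall (h : ∀ z, z ≠ 0 → P z) : NearlyEverywhere P := fun _ hw =>
  eventually_nhdsWithin_of_eventually_nhds ((isOpen_ne.eventually_mem hw).mono h)

lemma mono (hP : NearlyEverywhere P) (h : ∀ z, z ≠ 0 → P z → Q z) : NearlyEverywhere Q :=
  fun w hw => by
    filter_upwards [hP w hw, of_forall (P := fun z => z ≠ 0) (fun _ h => h) w hw] with z h1 h2
    exact h z h2 h1

lemma and (hP : NearlyEverywhere P) (hQ : NearlyEverywhere Q) :
    NearlyEverywhere fun z => P z ∧ Q z := fun w hw => (hP w hw).and (hQ w hw)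

lemma forall_lt {P : ℕ → ℂ → Prop} {n : ℕ} (h : ∀ i < n, NearlyEverywhere (P i)) :
    NearlyEverywhere fun z => ∀ i < n, P i z := fun w hw => by
  simpa using (Filter.eventually_all_finset (Finset.range n)).2
    fun i hi => h i (Finset.mem_range.1 hi) w hw

lemma comp_mul (hP : NearlyEverywhere P) {a : ℂ} (ha : a ≠ 0) :
    NearlyEverywhere fun z => P (a * z) := fun w hw => by
  have ht : Tendsto (fun z : ℂ => a * z) (𝓝[≠] w) (𝓝[≠] (a * w)) :=
    tendsto_nhdsWithin_of_tendsto_nhds_of_eventually_within _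
      (((continuous_const_mul a).tendsto w).mono_left nhdsWithin_le_nhds)
      (eventually_nhdsWithin_of_forall fun z hz h => hz (mul_left_cancel₀ ha h))
  exact ht.eventually (hP (a * w) (mul_ne_zero ha hw))

lemma comp_div (hP : NearlyEverywhere P) {a : ℂ} (ha : a ≠ 0) :
    NearlyEverywhere fun z => P (z / a) := by
  simpa only [div_eq_inv_mul] using hP.comp_mul (inv_ne_zero ha)

/-- Identity theorem on the connected set ℂ ∖ {0}: zeros accumulating at a nonzero point would force
h to vanish at x. -/
lemma of_differentiable {h : ℂ → ℂ} (hd : ∀ z, z ≠ 0 → DifferentiableAt ℂ h z)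
    {x : ℂ} (hx0 : x ≠ 0) (hx : h x ≠ 0) : NearlyEverywhere fun z => h z ≠ 0 := by
  have hA : AnalyticOnNhd ℂ h {0}ᶜ := (DifferentiableOn.analyticOnNhd (fun z hz =>
    (hd z hz).differentiableWithinAt) isOpen_compl_singleton)
  have hc : IsPreconnected ({0}ᶜ : Set ℂ) :=
    (isConnected_compl_singleton_of_one_lt_rank (by simp) 0).isPreconnected
  intro w hw
  refine (hA w hw).eventually_eq_zero_or_eventually_ne_zero.resolve_left fun h0 => hx ?_
  exact hA.eqOn_zero_of_preconnected_of_eventuallyEq_zero hc hw h0 hx0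

end NearlyEverywhere

section Generic

variable {p : ℂ}

lemma nearlyEverywhere_modTheta_mul (hp1 : ‖p‖ < 1) {a : ℂ} (ha : a ≠ 0) :
    NearlyEverywhere fun z => modTheta (a * z) p ≠ 0 := by
  obtain ⟨x, hx0, hx⟩ := exists_modTheta_ne_zero hp1
  exact (NearlyEverywhere.of_differentiable (fun z hz => differentiableAt_modTheta hp1 hz)
    hx0 hx).comp_mul ha

lemma nearlyEverywhere_modTheta_div (hp1 : ‖p‖ < 1) {a : ℂ} (ha : a ≠ 0) :
    NearlyEverywhere fun z => modTheta (a / z) p ≠ 0 := by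
  obtain ⟨x, hx0, hx⟩ := exists_modTheta_ne_zero hp1
  refine NearlyEverywhere.of_differentiable (fun z hz => ?_) (x := a / x) (div_ne_zero ha hx0)
    (by rwa [div_div_cancel₀ ha])
  exact (differentiableAt_modTheta hp1 (div_ne_zero ha hz)).comp z
    ((differentiableAt_const a).div differentiableAt_id hz)

lemma nearlyEverywhere_modTheta_sq (hp1 : ‖p‖ < 1) :
    NearlyEverywhere fun z => modTheta (z ^ 2) p ≠ 0 := by
  obtain ⟨x, hx0, hx⟩ := exists_modTheta_ne_zero hp1
  obtain ⟨y, hy⟩ := IsAlgClosed.exists_pow_nat_eq x (n := 2) (by norm_num)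
  refine NearlyEverywhere.of_differentiable (fun z hz => ?_) (x := y) (by rintro rfl; simp_all)
    (by rwa [hy])
  exact (differentiableAt_modTheta hp1 (pow_ne_zero 2 hz)).comp z (differentiableAt_pow 2)

lemma nearlyEverywhere_thetaFactorialPair (hp1 : ‖p‖ < 1) {a b : ℂ} (ha : a ≠ 0) (hb : b ≠ 0)
    (n : ℕ) : NearlyEverywhere fun z => thetaFactorialPair a b p n z ≠ 0 := by
  have h : NearlyEverywhere fun z => ∀ i < n,
      modTheta (a * b ^ i * z) p ≠ 0 ∧ modTheta (a * b ^ i / z) p ≠ 0 :=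
    NearlyEverywhere.forall_lt fun i _ =>
      have hi : a * b ^ i ≠ 0 := mul_ne_zero ha (pow_ne_zero i hb)
      (nearlyEverywhere_modTheta_mul hp1 hi).and (nearlyEverywhere_modTheta_div hp1 hi)
  refine h.mono fun z _ hz => mul_ne_zero (Finset.prod_ne_zero_iff.2 fun i hi => ?_)
    (Finset.prod_ne_zero_iff.2 fun i hi => ?_)
  · rw [mul_right_comm]
    exact (hz i (Finset.mem_range.1 hi)).1
  · rw [div_mul_eq_mul_div]
    exact (hz i (Finset.mem_range.1 hi)).2

end Generic

/-! ### Laurent coefficients through Fourier series on circles. -/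

section LaurentCoefficients

open MeasureTheory AddCircle

instance fact_two_pi_pos : Fact (0 < 2 * Real.pi) := ⟨Real.two_pi_pos⟩

/-- The `m`-th Fourier coefficient of `t ↦ g (R e^{it})`. -/
noncomputable def circleCoeff (g : ℂ → ℂ) (R : ℝ) (m : ℤ) : ℂ :=
  fourierCoeff (fun t : AddCircle (2 * Real.pi) => g (R * (toCircle t : ℂ))) m

lemma toCircle_two_pi_coe (x : ℝ) :
    ((toCircle (x : AddCircle (2 * Real.pi)) : Circle) : ℂ) = Complex.exp (x * Complex.I) := by
  rw [toCircle_apply_mk, div_self Real.two_pi_pos.ne', one_mul, Circle.coe_exp]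

lemma fourier_apply_eq_zpow (m : ℤ) (t : AddCircle (2 * Real.pi)) :
    fourier m t = (toCircle t : ℂ) ^ m := by
  rw [fourier_apply, toCircle_zsmul, Circle.coe_zpow]

lemma circleIntegral_zpow_mul {g : ℂ → ℂ} {R : ℝ} (hR : 0 < R) (m : ℤ) :
    (∮ z in C(0, R), z ^ (-m - 1) * g z) =
      2 * Real.pi * Complex.I * (R : ℂ) ^ (-m) * circleCoeff g R m := by
  have hR' : (R : ℂ) ≠ 0 := by exact_mod_cast hR.ne'
  have hpi : (Real.pi : ℂ) ≠ 0 := by exact_mod_cast Real.pi_ne_zero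
  rw [circleCoeff, fourierCoeff_eq_intervalIntegral _ m 0, circleIntegral, zero_add,
    Complex.real_smul]
  have h : ∀ x : ℝ, deriv (circleMap 0 R) x •
      ((circleMap 0 R x) ^ (-m - 1) * g (circleMap 0 R x)) =
      (Complex.I * (R : ℂ) ^ (-m)) * (fourier (-m) (x : AddCircle (2 * Real.pi)) •
        g (R * (toCircle (x : AddCircle (2 * Real.pi)) : ℂ))) := fun x => by
    rw [deriv_circleMap, fourier_apply_eq_zpow, toCircle_two_pi_coe]
    have he : circleMap 0 R x = R * Complex.exp (x * Complex.I) := by simp [circleMap]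
    have hne : circleMap 0 R x ≠ 0 := by
      rw [he]; exact mul_ne_zero hR' (Complex.exp_ne_zero _)
    rw [zpow_sub_one₀ hne, smul_eq_mul, smul_eq_mul]
    have : circleMap 0 R x ^ (-m) = (R : ℂ) ^ (-m) * Complex.exp (x * Complex.I) ^ (-m) := by
      rw [he, mul_zpow]
    rw [this, ← he]
    field_simp
  simp_rw [h]
  rw [intervalIntegral.integral_const_mul]
  push_cast
  field_simp

/-- Cauchy's theorem on the annulus: both sides are the m-th Laurent coefficient, which does not
depend on the radius. -/
lemma circleCoeff_mul_zpow {g : ℂ → ℂ} (hg : DifferentiableOn ℂ g {0}ᶜ) {r R : ℝ} (hr : 0 < r)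
    (hrR : r ≤ R) (m : ℤ) :
    (R : ℂ) ^ (-m) * circleCoeff g R m = (r : ℂ) ^ (-m) * circleCoeff g r m := by
  have hR : 0 < R := hr.trans_le hrR
  have hd : ∀ z : ℂ, z ≠ 0 → DifferentiableAt ℂ (fun z => z ^ (-m - 1) * g z) z := fun z hz =>
    (differentiableAt_zpow.2 (Or.inl hz)).mul
      ((hg z hz).differentiableAt (isOpen_compl_singleton.mem_nhds hz))
  have h := Complex.circleIntegral_eq_of_differentiable_on_annulus_off_countable hr hrR (c := 0)
    (f := fun z => z ^ (-m - 1) * g z) Set.countable_empty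
    (fun z hz => (hd z (by rintro rfl; simp [hr] at hz)).continuousAt.continuousWithinAt)
    (fun z hz => hd z (by rintro rfl; simp [hr.le] at hz))
  rw [circleIntegral_zpow_mul hR, circleIntegral_zpow_mul hr, mul_assoc _ _ (circleCoeff _ _ _),
    mul_assoc _ _ (circleCoeff _ _ _)] at h
  refine mul_left_cancel₀ ?_ h
  simp [Real.pi_ne_zero]

lemma continuous_circle_restrict {g : ℂ → ℂ} (hg : DifferentiableOn ℂ g {0}ᶜ) :
    Continuous fun t : AddCircle (2 * Real.pi) => g (((1 : ℝ) : ℂ) * (toCircle t : ℂ)) := by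
  simp only [Complex.ofReal_one, one_mul]
  exact hg.continuousOn.comp_continuous (by fun_prop)
    fun t => Circle.coe_ne_zero _

lemma circleCoeff_add {g h : ℂ → ℂ} (hg : DifferentiableOn ℂ g {0}ᶜ)
    (hh : DifferentiableOn ℂ h {0}ᶜ) (m : ℤ) :
    circleCoeff (fun z => g z + h z) 1 m = circleCoeff g 1 m + circleCoeff h 1 m := by
  have hi : ∀ {g : ℂ → ℂ}, DifferentiableOn ℂ g {0}ᶜ → Integrable
      (fun t : AddCircle (2 * Real.pi) => g (((1 : ℝ) : ℂ) * (toCircle t : ℂ))) haarAddCircle :=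
    fun hg => (continuous_circle_restrict hg).integrable_of_hasCompactSupport
      (HasCompactSupport.of_compactSpace _)
  exact congrFun (fourierCoeff.add (hi hg) (hi hh)) m

lemma circleCoeff_const_mul (c : ℂ) (g : ℂ → ℂ) (m : ℤ) :
    circleCoeff (fun z => c * g z) 1 m = c * circleCoeff g 1 m :=
  fourierCoeff.const_mul
    (fun t : AddCircle (2 * Real.pi) => g (((1 : ℝ) : ℂ) * (toCircle t : ℂ))) c m

/-- The Fourier series gives g = 0 on the unit circle, which accumulates at 1, so the identity
theorem applies. -/
lemma eq_zero_of_circleCoeff_eq_zero {g : ℂ → ℂ} (hg : DifferentiableOn ℂ g {0}ᶜ)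
    (h : ∀ m, circleCoeff g 1 m = 0) {z : ℂ} (hz : z ≠ 0) : g z = 0 := by
  set F : C(AddCircle (2 * Real.pi), ℂ) := ⟨_, continuous_circle_restrict hg⟩ with hF
  have hc : fourierCoeff F = 0 := funext h
  have hs : HasSum (fun i => fourierCoeff F i • fourier i) F :=
    hasSum_fourier_series_of_summable (by rw [hc]; exact summable_zero)
  have hF0 : F = 0 := hs.unique (by simp [hc])
  by_contra hne
  have hev := NearlyEverywhere.of_differentiable
    (fun z hz => (hg z hz).differentiableAt (isOpen_compl_singleton.mem_nhds hz)) hz hne 1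
    one_ne_zero
  have ht : Tendsto (fun x : ℝ => Complex.exp (x * Complex.I)) (𝓝[≠] 0) (𝓝[≠] 1) := by
    refine tendsto_nhdsWithin_of_tendsto_nhds_of_eventually_within _ ?_ ?_
    · have : Continuous fun x : ℝ => Complex.exp (x * Complex.I) := by fun_prop
      simpa using (this.tendsto 0).mono_left (nhdsWithin_le_nhds (s := {0}ᶜ))
    · have hlt : ∀ᶠ x : ℝ in 𝓝[≠] 0, x ∈ Set.Ioo (-1 : ℝ) 1 :=
        eventually_nhdsWithin_of_eventually_nhds (Ioo_mem_nhds (by norm_num) (by norm_num))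
      filter_upwards [hlt, self_mem_nhdsWithin] with x hx hx0 h1
      obtain ⟨k, hk⟩ := Complex.exp_eq_one_iff.1 h1
      have hk' : x = k * (2 * Real.pi) := by
        have := congrArg Complex.im hk
        simpa using this
      rcases eq_or_ne k 0 with rfl | hk0
      · simp at hk'; exact hx0 hk'
      · have h1 : (1 : ℝ) ≤ |(k : ℝ)| := by exact_mod_cast Int.one_le_abs hk0
        have h2 : |x| < 1 := abs_lt.2 hx
        rw [hk', abs_mul, abs_of_pos Real.two_pi_pos] at h2
        nlinarith [Real.pi_gt_three]
  obtain ⟨x, hx⟩ := (ht.eventually hev).exists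
  apply hx
  have := DFunLike.congr_fun hF0 (x : AddCircle (2 * Real.pi))
  simpa [hF, toCircle_two_pi_coe] using this

end LaurentCoefficients

/-! ### Dimension bound for even theta functions. -/

section EvenTheta

open MeasureTheory AddCircle

variable {p : ℂ} {n : ℕ} {g : ℂ → ℂ}

/-- On the unit circle z ↦ 1/z is t ↦ -t, which preserves Haar measure. -/
lemma IsEvenTheta.circleCoeff_neg (hg : IsEvenTheta p n g) (m : ℤ) :
    circleCoeff g 1 (-m) = circleCoeff g 1 m := by
  unfold circleCoeff fourierCoeff
  rw [← integral_neg_eq_self]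
  refine integral_congr_ae (.of_forall fun t => ?_)
  simp only [fourier_apply_eq_zpow, Complex.ofReal_one, one_mul, neg_neg, toCircle_neg,
    Circle.coe_inv, inv_zpow', smul_eq_mul]
  rw [hg.symm _ (Circle.coe_ne_zero (toCircle t)), one_div]

/-- Multiplication by p carries the unit circle to the circle of radius |p|, and the factor z^{-2n}
in the quasiperiodicity shifts the Fourier index by 2n. Independence of the radius then relates the
two coefficients. -/
lemma IsEvenTheta.circleCoeff_add_two_mul (hp0 : p ≠ 0) (hp1 : ‖p‖ < 1) (hg : IsEvenTheta p n g)
    (m : ℤ) : circleCoeff g 1 (m + 2 * n) = p ^ (m + n) * circleCoeff g 1 m := by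
  have hpn : (‖p‖ : ℂ) ≠ 0 := by exact_mod_cast norm_ne_zero_iff.2 hp0
  have h1 := circleCoeff_mul_zpow hg.holomorphic (norm_pos_iff.2 hp0) hp1.le m
  have hu : (‖p‖ : ℂ) * (toCircle ((p.arg : ℝ) : AddCircle (2 * Real.pi)) : ℂ) = p := by
    rw [toCircle_two_pi_coe, Complex.norm_mul_exp_arg_mul_I]
  set u : ℂ := (toCircle ((p.arg : ℝ) : AddCircle (2 * Real.pi)) : ℂ) with hudef
  have hu0 : u ≠ 0 := Circle.coe_ne_zero _
  have h2 : circleCoeff g ‖p‖ m = u ^ (-m) * (1 / p ^ n) * circleCoeff g 1 (m + 2 * n) := by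
    unfold circleCoeff fourierCoeff
    -- Translation by arg p turns |p|·z into p·z under the integral.
    rw [← integral_add_right_eq_self _ ((p.arg : ℝ) : AddCircle (2 * Real.pi)),
      ← integral_const_mul]
    refine integral_congr_ae (.of_forall fun t => ?_)
    have hz := Circle.coe_ne_zero (toCircle t)
    simp only [fourier_apply_eq_zpow, Complex.ofReal_one, one_mul, toCircle_add, Circle.coe_mul,
      smul_eq_mul, ← hudef]
    rw [show (‖p‖ : ℂ) * ((toCircle t : ℂ) * u) = p * toCircle t by
      linear_combination (toCircle t : ℂ) * hu, hg.quasiperiodic _ hz, mul_zpow,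
      show -(m + 2 * (n : ℤ)) = -m - ((2 * n : ℕ) : ℤ) by push_cast; ring, zpow_sub₀ hz,
      zpow_natCast]
    field_simp
  rw [h2] at h1
  simp only [Complex.ofReal_one, one_zpow, one_mul] at h1
  rw [h1, zpow_add₀ hp0, zpow_natCast]
  have : p ^ m = (‖p‖ : ℂ) ^ m * u ^ m := by rw [← mul_zpow, hu]
  rw [this, zpow_neg, zpow_neg]
  have h3 := zpow_ne_zero m hpn
  have h4 := zpow_ne_zero m hu0
  field_simp

lemma IsEvenTheta.eq_zero_of_circleCoeff (hp0 : p ≠ 0) (hp1 : ‖p‖ < 1) (hg : IsEvenTheta p n g)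
    (h : ∀ m : ℕ, m ≤ n → circleCoeff g 1 m = 0) {z : ℂ} (hz : z ≠ 0) : g z = 0 := by
  have hstep := hg.circleCoeff_add_two_mul hp0 hp1
  refine eq_zero_of_circleCoeff_eq_zero hg.holomorphic (fun m => ?_) hz
  suffices hnat : ∀ m : ℕ, circleCoeff g 1 m = 0 by
    obtain ⟨k, rfl | rfl⟩ := m.eq_nat_or_neg
    · exact hnat k
    · rw [hg.circleCoeff_neg]; exact hnat k
  intro m
  induction m using Nat.strong_induction_on with
  | _ m ih =>
    rcases le_or_gt m n with hm | hm
    · exact h m hm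
    rcases Nat.eq_zero_or_pos n with rfl | hn
    -- For n = 0 the recursion does not move the index; it reads (p^m - 1) a_m = 0 with p^m ≠ 1.
    · have := hstep m
      simp only [Nat.cast_zero, mul_zero, add_zero, zpow_natCast] at this
      have hpm : p ^ m ≠ 1 := fun h1 => by
        have h2 := pow_lt_one₀ (norm_nonneg p) hp1 hm.ne'
        rw [← norm_pow, h1] at h2
        simp at h2
      exact (mul_eq_zero.1 (show (p ^ m - 1) * circleCoeff g 1 m = 0 by
        linear_combination -this)).resolve_left (sub_ne_zero.2 hpm)
    -- For m > n > 0 one has |m - 2n| < m, so the recursion followed by the symmetry reaches a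
    -- smaller index.
    · have := hstep (m - 2 * n)
      rw [sub_add_cancel] at this
      rw [this]
      rcases le_total (2 * n) m with h2 | h2
      · rw [show (m : ℤ) - 2 * n = ((m - 2 * n : ℕ) : ℤ) by push_cast [h2]; ring,
          ih _ (by omega), mul_zero]
      · rw [show (m : ℤ) - 2 * n = -((2 * n - m : ℕ) : ℤ) by push_cast [h2]; ring,
          hg.circleCoeff_neg, ih _ (by omega), mul_zero]

lemma IsEvenTheta.add {h : ℂ → ℂ} (hg : IsEvenTheta p n g) (hh : IsEvenTheta p n h) :
    IsEvenTheta p n fun z => g z + h z where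
  holomorphic := hg.holomorphic.add hh.holomorphic
  symm z hz := by rw [hg.symm z hz, hh.symm z hz]
  quasiperiodic z hz := by rw [hg.quasiperiodic z hz, hh.quasiperiodic z hz]; ring

lemma IsEvenTheta.const_mul (hg : IsEvenTheta p n g) (c : ℂ) :
    IsEvenTheta p n fun z => c * g z where
  holomorphic := hg.holomorphic.const_mul c
  symm z hz := by rw [hg.symm z hz]
  quasiperiodic z hz := by rw [hg.quasiperiodic z hz]; ring

lemma IsEvenTheta.mul {k : ℕ} {h : ℂ → ℂ} (hg : IsEvenTheta p n g) (hh : IsEvenTheta p k h) :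
    IsEvenTheta p (n + k) fun z => g z * h z where
  holomorphic := hg.holomorphic.mul hh.holomorphic
  symm z hz := by rw [hg.symm z hz, hh.symm z hz]
  quasiperiodic z hz := by
    rw [hg.quasiperiodic z hz, hh.quasiperiodic z hz]
    simp only [div_eq_mul_inv, mul_inv, one_mul, pow_add, mul_add]
    ring

lemma isEvenTheta_const (p c : ℂ) : IsEvenTheta p 0 fun _ => c where
  holomorphic := differentiableOn_const c
  symm _ _ := rfl
  quasiperiodic z hz := by simp

lemma isEvenTheta_zero (p : ℂ) (n : ℕ) : IsEvenTheta p n fun _ => 0 where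
  holomorphic := differentiableOn_const 0
  symm _ _ := rfl
  quasiperiodic z hz := by simp

lemma isEvenTheta_sum {ι : Type*} (s : Finset ι) {G : ι → ℂ → ℂ}
    (hG : ∀ i ∈ s, IsEvenTheta p n (G i)) (b : ι → ℂ) :
    IsEvenTheta p n fun z => ∑ i ∈ s, b i * G i z := by
  classical
  induction s using Finset.induction_on with
  | empty => simpa using isEvenTheta_zero p n
  | insert i s hi ih =>
    simp only [Finset.sum_insert hi]
    exact ((hG i (by simp)).const_mul (b i)).add
      (ih fun j hj => hG j (Finset.mem_insert_of_mem hj))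

lemma circleCoeff_sum {ι : Type*} (s : Finset ι) {G : ι → ℂ → ℂ}
    (hG : ∀ i ∈ s, IsEvenTheta p n (G i)) (b : ι → ℂ) (m : ℤ) :
    circleCoeff (fun z => ∑ i ∈ s, b i * G i z) 1 m = ∑ i ∈ s, b i * circleCoeff (G i) 1 m := by
  classical
  induction s using Finset.induction_on with
  | empty => simpa using circleCoeff_const_mul 0 (fun _ => 0) m
  | insert i s hi ih =>
    have hG' : ∀ j ∈ s, IsEvenTheta p n (G j) := fun j hj => hG j (Finset.mem_insert_of_mem hj)
    simp only [Finset.sum_insert hi]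
    rw [circleCoeff_add ((hG i (by simp)).const_mul (b i)).holomorphic
      (isEvenTheta_sum s hG' b).holomorphic, circleCoeff_const_mul, ih hG']

/-- The even theta functions of order `2n` form a space of dimension at most `n + 1`: any `n + 1`
of them that are linearly independent on `z ≠ 0` span. -/
theorem IsEvenTheta.exists_eq_sum (hp0 : p ≠ 0) (hp1 : ‖p‖ < 1) {G : Fin (n + 1) → ℂ → ℂ}
    (hG : ∀ i, IsEvenTheta p n (G i))
    (hind : ∀ b : Fin (n + 1) → ℂ, (∀ z, z ≠ 0 → ∑ i, b i * G i z = 0) → b = 0)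
    (hg : IsEvenTheta p n g) :
    ∃ b : Fin (n + 1) → ℂ, ∀ z, z ≠ 0 → g z = ∑ i, b i * G i z := by
  set V : Fin (n + 1) → Fin (n + 1) → ℂ := fun i m => circleCoeff (G i) 1 (m : ℕ) with hV
  -- Independence passes from functions to vectors of coefficients 0, …, n, and n + 1 independent
  -- vectors span ℂ^{n+1}.
  have hli : LinearIndependent ℂ V := by
    rw [Fintype.linearIndependent_iff]
    intro b hb
    refine congrFun (hind b fun z hz => ?_)
    refine (isEvenTheta_sum Finset.univ (fun i _ => hG i) b).eq_zero_of_circleCoeff hp0 hp1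
      (fun m hm => ?_) hz
    rw [circleCoeff_sum _ (fun i _ => hG i)]
    simpa [hV] using congrFun hb ⟨m, by omega⟩
  have hspan := hli.span_eq_top_of_card_eq_finrank (by simp)
  have hmem : (fun m : Fin (n + 1) => circleCoeff g 1 (m : ℕ)) ∈ Submodule.span ℂ (Set.range V) := by
    rw [hspan]; trivial
  obtain ⟨b, hb⟩ := (Submodule.mem_span_range_iff_exists_fun ℂ).1 hmem
  refine ⟨b, fun z hz => ?_⟩
  have hsum := isEvenTheta_sum Finset.univ (fun i _ => hG i) b
  have h0 := (hg.add (hsum.const_mul (-1))).eq_zero_of_circleCoeff hp0 hp1 (fun m hm => ?_) hz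
  · linear_combination h0
  rw [circleCoeff_add hg.holomorphic (hsum.const_mul (-1)).holomorphic, circleCoeff_const_mul,
    circleCoeff_sum _ (fun i _ => hG i)]
  have := congrFun hb ⟨m, by omega⟩
  simp only [hV, Finset.sum_apply, Pi.smul_apply, smul_eq_mul] at this
  rw [this]
  ring

end EvenTheta

/-! ### Weierstrass' addition formula. -/

section AdditionFormula

variable {p : ℂ}

lemma isEvenTheta_modTheta_mul (hp0 : p ≠ 0) (hp1 : ‖p‖ < 1) {a : ℂ} (ha : a ≠ 0) :
    IsEvenTheta p 1 fun z => modTheta (a * z) p * modTheta (a / z) p where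
  holomorphic z hz := by
    have hz' : z ≠ 0 := hz
    refine (DifferentiableAt.mul ?_ ?_).differentiableWithinAt
    · exact (differentiableAt_modTheta hp1 (mul_ne_zero ha hz')).comp z
        (differentiableAt_id.const_mul a)
    · exact (differentiableAt_modTheta hp1 (div_ne_zero ha hz')).comp z
        ((differentiableAt_const a).div differentiableAt_id hz')
  symm z hz := by
    rw [mul_one_div, div_div_eq_mul_div, div_one, mul_comm]
  quasiperiodic z hz := by
    have h1 := modTheta_mul_left hp0 hp1 (mul_ne_zero ha hz)
    have h2 := modTheta_mul_left hp0 hp1 (x := a / (p * z)) (by positivity)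
    rw [show p * (a / (p * z)) = a / z by field_simp] at h2
    rw [show a * (p * z) = p * (a * z) by ring, h1, h2]
    field_simp
    ring

lemma isEvenTheta_thetaFactorialPair (hp0 : p ≠ 0) (hp1 : ‖p‖ < 1) {a b : ℂ} (ha : a ≠ 0)
    (hb : b ≠ 0) (n : ℕ) : IsEvenTheta p n (thetaFactorialPair a b p n) := by
  induction n with
  | zero =>
    convert isEvenTheta_const p 1 using 2 with z
    simp [thetaFactorialPair, thetaFactorial]
  | succ n ih =>
    convert ih.mul (isEvenTheta_modTheta_mul hp0 hp1 (mul_ne_zero ha (pow_ne_zero n hb))) using 2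
      with z
    simp only [thetaFactorialPair, thetaFactorial, Finset.prod_range_succ]
    rw [mul_right_comm a z, div_mul_eq_mul_div]
    ring

/-- The function `θ(xy) θ(y/x) / y`, antisymmetric in `x` and `y`. -/
noncomputable def thetaBracket (p x y : ℂ) : ℂ := modTheta (y * x) p * modTheta (y / x) p / y

lemma thetaBracket_swap (hp1 : ‖p‖ < 1) {x y : ℂ} (hx : x ≠ 0) (hy : y ≠ 0) :
    thetaBracket p y x = -thetaBracket p x y := by
  have h := modTheta_inv hp1 (div_ne_zero hy hx)
  rw [one_div_div] at h
  unfold thetaBracket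
  rw [h, mul_comm x y]
  field_simp

lemma thetaBracket_self (hp1 : ‖p‖ < 1) {x : ℂ} (hx : x ≠ 0) : thetaBracket p x x = 0 := by
  simp [thetaBracket, div_self hx, modTheta_one hp1]

lemma isEvenTheta_thetaBracket (hp0 : p ≠ 0) (hp1 : ‖p‖ < 1) {y : ℂ} (hy : y ≠ 0) :
    IsEvenTheta p 1 fun x => thetaBracket p x y := by
  convert (isEvenTheta_modTheta_mul hp0 hp1 hy).const_mul y⁻¹ using 2 with x
  unfold thetaBracket
  ring

/-- The brackets [x,u] and [x,v] vanish at u and v respectively, so for [u,v] ≠ 0 they form a basis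
in order 2, and the values at u and v determine the coefficients. -/
lemma IsEvenTheta.eq_zero_of_two_zeros (hp0 : p ≠ 0) (hp1 : ‖p‖ < 1) {h : ℂ → ℂ}
    (hh : IsEvenTheta p 1 h) {u v : ℂ} (hu : u ≠ 0) (hv : v ≠ 0) (huv : thetaBracket p u v ≠ 0)
    (h1 : h u = 0) (h2 : h v = 0) {z : ℂ} (hz : z ≠ 0) : h z = 0 := by
  have key : ∀ a b : ℂ, a * thetaBracket p u u + b * thetaBracket p u v = 0 →
      a * thetaBracket p v u + b * thetaBracket p v v = 0 → a = 0 ∧ b = 0 := fun a b e1 e2 => by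
    rw [thetaBracket_self hp1 hu, mul_zero, zero_add] at e1
    rw [thetaBracket_self hp1 hv, mul_zero, add_zero, thetaBracket_swap hp1 hu hv] at e2
    exact ⟨(mul_eq_zero.1 e2).resolve_right (neg_ne_zero.2 huv),
      (mul_eq_zero.1 e1).resolve_right huv⟩
  obtain ⟨b, hb⟩ := IsEvenTheta.exists_eq_sum hp0 hp1
    (G := ![fun x => thetaBracket p x u, fun x => thetaBracket p x v])
    (fun i => by
      fin_cases i
      · exact isEvenTheta_thetaBracket hp0 hp1 hu
      · exact isEvenTheta_thetaBracket hp0 hp1 hv)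
    (fun b hb => by
      have e1 := (Fin.sum_univ_two _).symm.trans (hb u hu)
      have e2 := (Fin.sum_univ_two _).symm.trans (hb v hv)
      obtain ⟨k0, k1⟩ := key _ _ e1 e2
      ext i
      fin_cases i
      · exact k0
      · exact k1) hh
  replace hb : ∀ z, z ≠ 0 → h z = b 0 * thetaBracket p z u + b 1 * thetaBracket p z v :=
    fun z hz => (hb z hz).trans (Fin.sum_univ_two _)
  obtain ⟨k0, k1⟩ := key _ _ ((hb u hu).symm.trans h1) ((hb v hv).symm.trans h2)
  rw [hb z hz, k0, k1]
  ring

/-- Weierstrass' addition formula. -/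
theorem thetaBracket_weierstrass (hp0 : p ≠ 0) (hp1 : ‖p‖ < 1) {x y u v : ℂ} (hx : x ≠ 0)
    (hy : y ≠ 0) (hu : u ≠ 0) (hv : v ≠ 0) :
    thetaBracket p x y * thetaBracket p u v + thetaBracket p x u * thetaBracket p v y +
      thetaBracket p x v * thetaBracket p y u = 0 := by
  -- As a function of x the left side has order 2 and vanishes at u and v.
  have key : ∀ {y u v : ℂ}, y ≠ 0 → u ≠ 0 → v ≠ 0 → thetaBracket p u v ≠ 0 →
      thetaBracket p x y * thetaBracket p u v + thetaBracket p x u * thetaBracket p v y +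
        thetaBracket p x v * thetaBracket p y u = 0 := by
    intro y u v hy hu hv huv
    have hE := (((isEvenTheta_thetaBracket hp0 hp1 hy).const_mul (thetaBracket p u v)).add
      ((isEvenTheta_thetaBracket hp0 hp1 hu).const_mul (thetaBracket p v y))).add
      ((isEvenTheta_thetaBracket hp0 hp1 hv).const_mul (thetaBracket p y u))
    have h := hE.eq_zero_of_two_zeros hp0 hp1 hu hv huv
      (by rw [thetaBracket_self hp1 hu, thetaBracket_swap hp1 hu hy]; ring)
      (by rw [thetaBracket_self hp1 hv, thetaBracket_swap hp1 hu hv]; ring) hx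
    linear_combination h
  -- The identity is cyclic in y, u, v, so any nonzero bracket among the three pairs suffices; if
  -- all vanish it is trivial.
  by_cases h1 : thetaBracket p u v = 0
  · by_cases h2 : thetaBracket p v y = 0
    · by_cases h3 : thetaBracket p y u = 0
      · rw [h1, h2, h3]; ring
      · linear_combination key hv hy hu h3
    · linear_combination key hu hv hy h2
  · exact key hy hu hv h1

/-- Weierstrass' formula at (mz, A/m, mC, z/m) with m² = AB. This form matches the difference
f(q^{1/2}z) - f(q^{-1/2}z), and its right side contains the θ(z²) to be cancelled. -/
theorem modTheta_addition (hp0 : p ≠ 0) (hp1 : ‖p‖ < 1) {A B C z : ℂ} (hA : A ≠ 0) (hB : B ≠ 0)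
    (hC : C ≠ 0) (hz : z ≠ 0) :
    modTheta (A * z) p * modTheta (B * z) p * modTheta (C * z) p * modTheta (A * B * C / z) p -
      z ^ 2 * (modTheta (A / z) p * modTheta (B / z) p * modTheta (C / z) p *
        modTheta (A * B * C * z) p) =
      modTheta (A * B) p * modTheta (A * C) p * modTheta (B * C) p * modTheta (z ^ 2) p := by
  obtain ⟨m, hm⟩ := IsAlgClosed.exists_pow_nat_eq (A * B) (n := 2) (by norm_num)
  have hm0 : m ≠ 0 := by
    rintro rfl
    exact mul_ne_zero hA hB (by rw [← hm]; norm_num)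
  have hBm : B = m ^ 2 / A := by rw [hm]; field_simp
  have h := thetaBracket_weierstrass hp0 hp1 (x := m * z) (y := A / m) (u := m * C) (v := z / m)
    (by positivity) (by positivity) (by positivity) (by positivity)
  have i1 := modTheta_inv hp1 (mul_ne_zero hB hz)
  have i2 := modTheta_inv hp1 (x := A * B * C / z) (by positivity)
  have i3 := modTheta_inv hp1 (div_ne_zero hB hz)
  have i4 := modTheta_inv hp1 (mul_ne_zero hA hB)
  have g1 : thetaBracket p (m * z) (A / m) =
      -(modTheta (A * z) p * modTheta (B * z) p) / (m * z) := by
    unfold thetaBracket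
    rw [show A / m * (m * z) = A * z by field_simp,
      show A / m / (m * z) = 1 / (B * z) by rw [hBm]; field_simp, i1, hBm]
    field_simp
  have g2 : thetaBracket p (m * C) (z / m) =
      -(modTheta (C * z) p * modTheta (A * B * C / z) p) / (m * C) := by
    unfold thetaBracket
    rw [show z / m * (m * C) = C * z by field_simp,
      show z / m / (m * C) = 1 / (A * B * C / z) by rw [← hm]; field_simp, i2, ← hm]
    field_simp
  have g3 : thetaBracket p (m * z) (m * C) =
      modTheta (A * B * C * z) p * modTheta (C / z) p / (m * C) := by
    unfold thetaBracket
    rw [show m * C * (m * z) = A * B * C * z by rw [← hm]; ring,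
      show m * C / (m * z) = C / z by field_simp]
  have g4 : thetaBracket p (z / m) (A / m) =
      -(modTheta (B / z) p * modTheta (A / z) p) * z / m := by
    unfold thetaBracket
    rw [show A / m * (z / m) = 1 / (B / z) by rw [hBm]; field_simp,
      show A / m / (z / m) = A / z by field_simp, i3, hBm]
    field_simp
  have g5 : thetaBracket p (m * z) (z / m) =
      -(modTheta (z ^ 2) p * modTheta (A * B) p) / (m * z) := by
    unfold thetaBracket
    rw [show z / m * (m * z) = z ^ 2 by field_simp,
      show z / m / (m * z) = 1 / (A * B) by rw [← hm]; field_simp, i4, ← hm]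
    field_simp
  have g6 : thetaBracket p (A / m) (m * C) =
      modTheta (A * C) p * modTheta (B * C) p / (m * C) := by
    unfold thetaBracket
    rw [show m * C * (A / m) = A * C by field_simp,
      show m * C / (A / m) = B * C by rw [hBm]; field_simp]
  rw [g1, g2, g3, g4, g5, g6] at h
  field_simp at h
  rw [mul_comm z B, mul_comm z C, show A * z * B * C = A * B * C * z by ring] at h
  linear_combination h

end AdditionFormula

/-! ### The lowering relation on the quadratic basis. -/

section Basis

variable {p : ℂ}

lemma thetaFactorial_succ (a b p : ℂ) (n : ℕ) :
    thetaFactorial a b p (n + 1) = thetaFactorial a b p n * modTheta (a * b ^ n) p :=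
  Finset.prod_range_succ _ _

lemma thetaFactorial_succ' (a b p : ℂ) (n : ℕ) :
    thetaFactorial a b p (n + 1) = modTheta a p * thetaFactorial (a * b) b p n := by
  rw [thetaFactorial, Finset.prod_range_succ', pow_zero, mul_one, mul_comm, thetaFactorial]
  congr 1
  exact Finset.prod_congr rfl fun i _ => by rw [pow_succ']; ring_nf

lemma thetaFactorialPair_inv (a b p : ℂ) (n : ℕ) (z : ℂ) :
    thetaFactorialPair a b p n z⁻¹ = thetaFactorialPair a b p n z := by
  rw [thetaFactorialPair, thetaFactorialPair, div_inv_eq_mul, ← div_eq_mul_inv, mul_comm]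

lemma thetaFactorialPair_add (a b p : ℂ) (k m : ℕ) (z : ℂ) :
    thetaFactorialPair a b p (k + m) z =
      thetaFactorialPair a b p k z * thetaFactorialPair (a * b ^ k) b p m z := by
  have h : ∀ x : ℂ, thetaFactorial x b p (k + m) =
      thetaFactorial x b p k * thetaFactorial (x * b ^ k) b p m := fun x => by
    simp only [thetaFactorial, Finset.prod_range_add, pow_add, mul_assoc]
  simp only [thetaFactorialPair, h]
  rw [mul_right_comm a z, div_mul_eq_mul_div]
  ring

/-- The shift z ↦ q^{1/2}z moves each product by one step of its base q^{1/2}. The new factor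
θ(1/(rz)) inverts to the missing θ(rz), so the pair of index k splits off; the opposite shift leaves
the same pair. -/
lemma thetaFactorialPair_mul_sqrt (hp1 : ‖p‖ < 1) {r z : ℂ} (hr : r ≠ 0) (hz : z ≠ 0) (k : ℕ) :
    thetaFactorialPair r (r ^ 2) p (k + 1) (r ^ 2 * z) =
      -(1 / (r * z)) * thetaFactorialPair r (r ^ 2) p k z *
        (modTheta (r * (r ^ 2) ^ k * z) p * modTheta (r * (r ^ 2) ^ (k + 1) * z) p) := by
  have h1 : modTheta (r * z) p * thetaFactorial (r * (r ^ 2 * z)) (r ^ 2) p (k + 1) =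
      thetaFactorial (r * z) (r ^ 2) p k * modTheta (r * z * (r ^ 2) ^ k) p *
        modTheta (r * z * (r ^ 2) ^ (k + 1)) p := by
    rw [← thetaFactorial_succ, ← thetaFactorial_succ, thetaFactorial_succ' _ _ _ (k + 1),
      show r * z * r ^ 2 = r * (r ^ 2 * z) by ring]
  have h2 : thetaFactorial (r / (r ^ 2 * z)) (r ^ 2) p (k + 1) =
      -modTheta (r * z) p / (r * z) * thetaFactorial (r / z) (r ^ 2) p k := by
    rw [thetaFactorial_succ', show r / (r ^ 2 * z) = 1 / (r * z) by field_simp,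
      modTheta_inv hp1 (mul_ne_zero hr hz), show 1 / (r * z) * r ^ 2 = r / z by field_simp]
  rw [thetaFactorialPair, thetaFactorialPair, h2, mul_right_comm r _ z, mul_right_comm r _ z]
  linear_combination (-(1 / (r * z)) * thetaFactorial (r / z) (r ^ 2) p k) * h1

lemma thetaFactorialPair_div_sqrt (hp1 : ‖p‖ < 1) {r z : ℂ} (hr : r ≠ 0) (hz : z ≠ 0) (k : ℕ) :
    thetaFactorialPair r (r ^ 2) p (k + 1) (z / r ^ 2) =
      -(z / r) * thetaFactorialPair r (r ^ 2) p k z *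
        (modTheta (r * (r ^ 2) ^ k / z) p * modTheta (r * (r ^ 2) ^ (k + 1) / z) p) := by
  have h := thetaFactorialPair_mul_sqrt (p := p) hp1 hr (inv_ne_zero hz) k
  rw [thetaFactorialPair_inv, show r ^ 2 * z⁻¹ = (z / r ^ 2)⁻¹ by field_simp,
    thetaFactorialPair_inv] at h
  rw [h]
  simp only [div_eq_mul_inv, mul_inv, inv_inv]
  ring

/-- Both shifts ±q^{1/2} lead to the pair with parameter cq^{3/2}, which is why the iterates change
c. The extra theta factor on the left completes the product in 1/z, which otherwise starts at cs/z.
-/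
lemma thetaFactorialPair_mul_base {c s z : ℂ} (hs : s ≠ 0) (k : ℕ) :
    thetaFactorialPair c (s ^ 2) p (k + 1) (s * z) * modTheta (c * s ^ (2 * k + 1) / z) p =
      modTheta (c * s * z) p * modTheta (c / s / z) p * modTheta (c * s / z) p *
        thetaFactorialPair (c * s ^ 3) (s ^ 2) p k z := by
  have h1 : thetaFactorial (c * (s * z)) (s ^ 2) p (k + 1) =
      modTheta (c * s * z) p * thetaFactorial (c * s ^ 3 * z) (s ^ 2) p k := by
    rw [thetaFactorial_succ', mul_assoc c s z,
      show c * (s * z) * s ^ 2 = c * s ^ 3 * z by ring]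
  have h2 : thetaFactorial (c / (s * z)) (s ^ 2) p (k + 1) =
      modTheta (c / s / z) p * thetaFactorial (c * s / z) (s ^ 2) p k := by
    rw [thetaFactorial_succ', div_div, show c / (s * z) * s ^ 2 = c * s / z by field_simp]
  have h3 : thetaFactorial (c * s / z) (s ^ 2) p k * modTheta (c * s ^ (2 * k + 1) / z) p =
      modTheta (c * s / z) p * thetaFactorial (c * s ^ 3 / z) (s ^ 2) p k := by
    have := (thetaFactorial_succ (c * s / z) (s ^ 2) p k).symm.trans (thetaFactorial_succ' _ _ _ _)
    rw [show c * s / z * (s ^ 2) ^ k = c * s ^ (2 * k + 1) / z by ring,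
      show c * s / z * s ^ 2 = c * s ^ 3 / z by ring] at this
    exact this
  rw [thetaFactorialPair, thetaFactorialPair, h1, h2]
  linear_combination (modTheta (c * s * z) p * thetaFactorial (c * s ^ 3 * z) (s ^ 2) p k *
    modTheta (c / s / z) p) * h3

lemma thetaFactorialPair_div_base {c s z : ℂ} (hs : s ≠ 0) (k : ℕ) :
    thetaFactorialPair c (s ^ 2) p (k + 1) (z / s) * modTheta (c * s ^ (2 * k + 1) * z) p =
      modTheta (c * s / z) p * modTheta (c * z / s) p * modTheta (c * s * z) p *
        thetaFactorialPair (c * s ^ 3) (s ^ 2) p k z := by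
  have h := thetaFactorialPair_mul_base (p := p) (c := c) (z := z⁻¹) hs k
  rw [thetaFactorialPair_inv, show s * z⁻¹ = (z / s)⁻¹ by field_simp,
    thetaFactorialPair_inv, div_inv_eq_mul, div_inv_eq_mul, div_inv_eq_mul, ← div_eq_mul_inv,
    div_mul_eq_mul_div c s z] at h
  exact h

/-- The quadratic basis function `(q^{1/4} z, q^{1/4} / z; q^{1/2}, p)_k / (c z, c / z; q, p)_k`,
with `r = q^{1/4}`. -/
noncomputable def quadraticBasis (r p c : ℂ) (k : ℕ) (z : ℂ) : ℂ :=
  thetaFactorialPair r (r ^ 2) p k z / thetaFactorialPair c (r ^ 4) p k z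

/-- The factor by which the elliptic Askey-Wilson operator lowers `quadraticBasis r p c (k + 1)`. -/
noncomputable def loweringFactor (r p c : ℂ) (k : ℕ) : ℂ :=
  -2 * r * (modTheta (r ^ 4 * (r ^ 4) ^ k) p * modTheta (c * r ^ (2 * (k : ℤ) - 1)) p *
    modTheta (c * r ^ (2 * (k : ℤ) + 1)) p) / modTheta (r ^ 4) p

lemma ellipticAW_quadraticBasis (hp0 : p ≠ 0) (hp1 : ‖p‖ < 1) {r c : ℂ} (hr : r ≠ 0) (hc : c ≠ 0)
    (k : ℕ) : NearlyEverywhere fun z =>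
      ellipticAW c (r ^ 2) p (quadraticBasis r p c (k + 1)) z =
        loweringFactor r p c k * quadraticBasis r p (c * (r ^ 2) ^ 3) k z := by
  have hs : r ^ 2 ≠ 0 := pow_ne_zero 2 hr
  have hE : c * (r ^ 2) ^ (2 * k + 1) ≠ 0 := mul_ne_zero hc (pow_ne_zero _ hs)
  refine ((((((((nearlyEverywhere_modTheta_sq hp1).and
    (nearlyEverywhere_modTheta_mul hp1 hE)).and (nearlyEverywhere_modTheta_div hp1 hE)).and
    (nearlyEverywhere_modTheta_mul hp1 (mul_ne_zero hc hs))).and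
    (nearlyEverywhere_modTheta_div hp1 (mul_ne_zero hc hs))).and
    (nearlyEverywhere_modTheta_div hp1 (div_ne_zero hc hs))).and
    (nearlyEverywhere_modTheta_mul hp1 (div_ne_zero hc hs))).and
    (nearlyEverywhere_thetaFactorialPair hp1 (mul_ne_zero hc (pow_ne_zero 3 hs))
      (pow_ne_zero 2 hs) k)).mono ?_
  rintro z hz ⟨⟨⟨⟨⟨⟨⟨t0, t1⟩, t2⟩, t3⟩, t4⟩, t5⟩, t6⟩, t7⟩
  rw [div_mul_eq_mul_div] at t6
  have d1 := thetaFactorialPair_mul_base (p := p) (c := c) (z := z) hs k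
  have d2 := thetaFactorialPair_div_base (p := p) (c := c) (z := z) hs k
  have n1 := thetaFactorialPair_mul_sqrt hp1 hr hz k
  have n2 := thetaFactorialPair_div_sqrt hp1 hr hz k
  -- A and B come from the numerators, C from the operator's prefactor, and ABC is the completing
  -- factor of the denominators.
  have hadd := modTheta_addition hp0 hp1 (A := r * (r ^ 2) ^ k) (B := r * (r ^ 2) ^ (k + 1))
    (C := c / r ^ 2) (z := z) (by positivity) (by positivity) (div_ne_zero hc hs) hz
  rw [show r * (r ^ 2) ^ k * (r * (r ^ 2) ^ (k + 1)) * (c / r ^ 2) = c * (r ^ 2) ^ (2 * k + 1) by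
      field_simp; ring,
    show r * (r ^ 2) ^ k * (r * (r ^ 2) ^ (k + 1)) = r ^ 4 * (r ^ 4) ^ k by ring,
    show r * (r ^ 2) ^ k * (c / r ^ 2) = c * r ^ (2 * (k : ℤ) - 1) by
      rw [zpow_sub₀ hr, zpow_mul, zpow_natCast, zpow_one]
      norm_cast
      field_simp,
    show r * (r ^ 2) ^ (k + 1) * (c / r ^ 2) = c * r ^ (2 * (k : ℤ) + 1) by
      rw [zpow_add₀ hr, zpow_mul, zpow_natCast, zpow_one]
      norm_cast
      field_simp
      ring, div_mul_eq_mul_div c _ z] at hadd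
  rw [show r ^ 4 = (r ^ 2) ^ 2 by ring] at hadd
  have e1 : quadraticBasis r p c (k + 1) (r ^ 2 * z) =
      thetaFactorialPair r (r ^ 2) p (k + 1) (r ^ 2 * z) *
        modTheta (c * (r ^ 2) ^ (2 * k + 1) / z) p /
      (modTheta (c * r ^ 2 * z) p * modTheta (c / r ^ 2 / z) p * modTheta (c * r ^ 2 / z) p *
        thetaFactorialPair (c * (r ^ 2) ^ 3) ((r ^ 2) ^ 2) p k z) := by
    rw [← d1, mul_div_mul_right _ _ t2, quadraticBasis, ← pow_mul]
  have e2 : quadraticBasis r p c (k + 1) (z / r ^ 2) =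
      thetaFactorialPair r (r ^ 2) p (k + 1) (z / r ^ 2) *
        modTheta (c * (r ^ 2) ^ (2 * k + 1) * z) p /
      (modTheta (c * r ^ 2 / z) p * modTheta (c * z / r ^ 2) p * modTheta (c * r ^ 2 * z) p *
        thetaFactorialPair (c * (r ^ 2) ^ 3) ((r ^ 2) ^ 2) p k z) := by
    rw [← d2, mul_div_mul_right _ _ t1, quadraticBasis, ← pow_mul]
  rw [ellipticAW, e1, e2, n1, n2, loweringFactor, quadraticBasis, mul_right_comm c z (r ^ 2),
    show r ^ 4 = (r ^ 2) ^ 2 by ring]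
  -- If θ(q) = 0, division by zero makes both sides 0.
  by_cases hq : modTheta ((r ^ 2) ^ 2) p = 0
  · simp [hq]
  generalize modTheta (c * r ^ (2 * (k : ℤ) - 1)) p = K1 at *
  generalize modTheta (c * r ^ (2 * (k : ℤ) + 1)) p = K2 at *
  generalize modTheta ((r ^ 2) ^ 2 * ((r ^ 2) ^ 2) ^ k) p = K3 at *
  generalize modTheta ((r ^ 2) ^ 2) p = K4 at *
  generalize modTheta (z ^ 2) p = x0 at *
  generalize modTheta (c * (r ^ 2) ^ (2 * k + 1) * z) p = x1 at *
  generalize modTheta (c * (r ^ 2) ^ (2 * k + 1) / z) p = x2 at *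
  generalize modTheta (c * r ^ 2 * z) p = x3 at *
  generalize modTheta (c * r ^ 2 / z) p = x4 at *
  generalize modTheta (c / r ^ 2 / z) p = x5 at *
  generalize modTheta (c * z / r ^ 2) p = x6 at *
  generalize thetaFactorialPair (c * (r ^ 2) ^ 3) ((r ^ 2) ^ 2) p k z = x7 at *
  generalize modTheta (r * (r ^ 2) ^ k * z) p = y1 at *
  generalize modTheta (r * (r ^ 2) ^ (k + 1) * z) p = y2 at *
  generalize modTheta (r * (r ^ 2) ^ k / z) p = y3 at *
  generalize modTheta (r * (r ^ 2) ^ (k + 1) / z) p = y4 at *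
  generalize thetaFactorialPair r (r ^ 2) p k z = P at *
  clear d1 d2 n1 n2 e1 e2
  field_simp
  linear_combination -P * hadd

end Basis

/-! ### Extraction of coefficients and the expansion. -/

section Expansion

variable {p : ℂ}

/-- The factor by which the `k`-th iterate of the elliptic Askey-Wilson operator takes
`quadraticBasis r p c (j + k)` to `quadraticBasis r p (c * (r ^ 2) ^ (3 * k)) j`. -/
noncomputable def iterLoweringFactor (r p : ℂ) (j : ℕ) : ℕ → ℂ → ℂ
  | 0, _ => 1
  | k + 1, c => loweringFactor r p c (j + k) * iterLoweringFactor r p j k (c * (r ^ 2) ^ 3)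

lemma quadraticBasis_zero (r p c z : ℂ) : quadraticBasis r p c 0 z = 1 := by
  simp [quadraticBasis, thetaFactorialPair, thetaFactorial]

lemma ellipticAW_sum_quadraticBasis (hp0 : p ≠ 0) (hp1 : ‖p‖ < 1) {r c : ℂ} (hr : r ≠ 0)
    (hc : c ≠ 0) {N : ℕ} {b : ℕ → ℂ} {f : ℂ → ℂ}
    (hf : NearlyEverywhere fun z =>
      f z = ∑ j ∈ Finset.range N, b j * quadraticBasis r p c j z) :
    NearlyEverywhere fun z => ellipticAW c (r ^ 2) p f z =
      ∑ j ∈ Finset.range (N - 1), b (j + 1) * loweringFactor r p c j *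
        quadraticBasis r p (c * (r ^ 2) ^ 3) j z := by
  have hs : r ^ 2 ≠ 0 := pow_ne_zero 2 hr
  have hlow := NearlyEverywhere.forall_lt (n := N - 1)
    fun k _ => ellipticAW_quadraticBasis hp0 hp1 hr hc k
  refine (((hf.comp_mul hs).and (hf.comp_div hs)).and hlow).mono ?_
  rintro z hz ⟨⟨h1, h2⟩, h3⟩
  rw [ellipticAW, h1, h2]
  rcases N with _ | N
  · simp
  rw [Nat.add_sub_cancel] at h3 ⊢
  -- The term of index 0 is constant, so the difference annihilates it.
  rw [Finset.sum_range_succ', Finset.sum_range_succ', quadraticBasis_zero, quadraticBasis_zero,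
    add_sub_add_right_eq_sub, ← Finset.sum_sub_distrib, Finset.mul_sum]
  refine Finset.sum_congr rfl fun j hj => ?_
  rw [mul_assoc (b (j + 1)), ← h3 j (Finset.mem_range.1 hj), ellipticAW]
  ring

lemma ellipticAWIter_sum_quadraticBasis (hp0 : p ≠ 0) (hp1 : ‖p‖ < 1) {r : ℂ} (hr : r ≠ 0)
    (k : ℕ) : ∀ {c : ℂ}, c ≠ 0 → ∀ {N : ℕ} {b : ℕ → ℂ} {f : ℂ → ℂ},
    (NearlyEverywhere fun z => f z = ∑ j ∈ Finset.range N, b j * quadraticBasis r p c j z) →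
    NearlyEverywhere fun z => ellipticAWIter (r ^ 2) p k c f z =
      ∑ j ∈ Finset.range (N - k), b (j + k) * iterLoweringFactor r p j k c *
        quadraticBasis r p (c * (r ^ 2) ^ (3 * k)) j z := by
  induction k with
  | zero =>
    intro c hc N b f hf
    simpa [ellipticAWIter, iterLoweringFactor] using hf
  | succ k ih =>
    intro c hc N b f hf
    have h := ih (mul_ne_zero hc (pow_ne_zero 3 (pow_ne_zero 2 hr)))
      (ellipticAW_sum_quadraticBasis hp0 hp1 hr hc hf)
    refine h.mono fun z _ hz => ?_
    rw [ellipticAWIter, hz, show N - 1 - k = N - (k + 1) by omega]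
    refine Finset.sum_congr rfl fun j _ => ?_
    rw [iterLoweringFactor, show c * (r ^ 2) ^ 3 * (r ^ 2) ^ (3 * k) =
      c * (r ^ 2) ^ (3 * (k + 1)) by ring, add_assoc j k 1]
    ring

lemma tendsto_quadraticBasis (hp0 : p ≠ 0) (hp1 : ‖p‖ < 1) {r c : ℂ} (hr : r ≠ 0) (hc : c ≠ 0)
    {j : ℕ} (h : thetaFactorialPair c (r ^ 4) p (j + 1) r ≠ 0) :
    Tendsto (quadraticBasis r p c (j + 1)) (𝓝[≠] r) (𝓝 0) := by
  have hcont : ∀ {a b : ℂ}, a ≠ 0 → b ≠ 0 → ∀ n, ContinuousAt (thetaFactorialPair a b p n) r :=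
    fun ha hb n => ((isEvenTheta_thetaFactorialPair hp0 hp1 ha hb n).holomorphic.differentiableAt
      (isOpen_compl_singleton.mem_nhds hr)).continuousAt
  have h0 : thetaFactorialPair r (r ^ 2) p (j + 1) r = 0 := by
    rw [thetaFactorialPair, thetaFactorial_succ' (r / r), div_self hr, modTheta_one hp1]
    ring
  have ht := ((hcont hr (pow_ne_zero 2 hr) (j + 1)).div (hcont hc (pow_ne_zero 4 hr) (j + 1))
    h).tendsto
  rw [Pi.div_apply, h0, zero_div] at ht
  exact ht.mono_left nhdsWithin_le_nhds

/-- The first two factors of the product of length 2(k + 1) are those of the first lowering step;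
the rest is the product of length 2k for cq^{3/2}. -/
lemma quadraticTaylorFactor_mul_iterLoweringFactor {r : ℂ} (hr : r ≠ 0) (k : ℕ) : ∀ {c : ℂ},
    thetaFactorial (r ^ 4) (r ^ 4) p k ≠ 0 →
    thetaFactorial (c * r ^ (2 * (k : ℤ) - 3)) (r ^ 2) p (2 * k) ≠ 0 →
    quadraticTaylorFactor c (r ^ 4) r p k * iterLoweringFactor r p 0 k c = 1 := by
  have key : ∀ c : ℂ, iterLoweringFactor r p 0 k c =
      (-2 * r) ^ k * thetaFactorial (r ^ 4) (r ^ 4) p k *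
        thetaFactorial (c * r ^ (2 * (k : ℤ) - 3)) (r ^ 2) p (2 * k) / modTheta (r ^ 4) p ^ k := by
    induction k with
    | zero => intro c; simp [iterLoweringFactor, thetaFactorial]
    | succ k ih =>
      intro c
      rw [iterLoweringFactor, ih, loweringFactor, zero_add, thetaFactorial_succ (r ^ 4),
        show 2 * (k + 1) = 2 * k + 1 + 1 by ring, thetaFactorial_succ' _ _ _ (2 * k + 1),
        thetaFactorial_succ' _ _ _ (2 * k),
        show (2 * ((k + 1 : ℕ) : ℤ) - 3) = 2 * (k : ℤ) - 1 by push_cast; ring]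
      have e1 : c * r ^ (2 * (k : ℤ) - 1) * r ^ 2 = c * r ^ (2 * (k : ℤ) + 1) := by
        rw [mul_assoc, ← zpow_natCast r 2, ← zpow_add₀ hr]
        congr 2
        push_cast
        ring
      have e2 : c * r ^ (2 * (k : ℤ) + 1) * r ^ 2 =
          c * (r ^ 2) ^ 3 * r ^ (2 * (k : ℤ) - 3) := by
        rw [← pow_mul, mul_assoc, mul_assoc, ← zpow_natCast r 2, ← zpow_natCast r (2 * 3),
          ← zpow_add₀ hr, ← zpow_add₀ hr]
        congr 2
        push_cast
        ring
      rw [e1, e2, pow_succ (-2 * r), pow_succ (modTheta (r ^ 4) p)]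
      generalize modTheta (r ^ 4) p ^ k = A
      simp only [div_eq_mul_inv, mul_inv]
      ring
  intro c h1 h2
  have h3 : modTheta (r ^ 4) p ^ k ≠ 0 := by
    rcases k with _ | k
    · simp
    · rw [thetaFactorial_succ'] at h1
      exact pow_ne_zero _ (left_ne_zero_of_mul h1)
  rw [key, quadraticTaylorFactor, zpow_neg, zpow_natCast, mul_pow, neg_pow (2 : ℂ) k]
  have h4 : ((-1 : ℂ) ^ k) * (-1) ^ k = 1 := by rw [← mul_pow]; norm_num
  field_simp
  linear_combination h4

/-- The genericity condition `(c q^{k/2 - 3/4}; q^{1/2}, p)_{2k} ≠ 0` for `1 ≤ k ≤ n` implies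
`θ(c q^{j/4}; p) ≠ 0` for all odd `j` with `-1 ≤ j ≤ 6n - 5`. -/
lemma modTheta_ne_zero_of_generic {r c : ℂ} (hr : r ≠ 0) {n : ℕ}
    (hgen : ∀ k ∈ Finset.Icc 1 n,
      thetaFactorial (c * r ^ (2 * (k : ℤ) - 3)) (r ^ 2) p (2 * k) ≠ 0)
    {i : ℕ} (hi : i + 2 ≤ 3 * n) : modTheta (c * r ^ (2 * (i : ℤ) - 1)) p ≠ 0 := by
  obtain ⟨k, h1, h2, h3⟩ : ∃ k, k ∈ Finset.Icc 1 n ∧ k ≤ i + 1 ∧ i + 1 < k + 2 * k :=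
    -- The k-th condition covers exponents 2k - 3, 2k - 1, …, 6k - 5; this is the least k with 2i -
    -- 1 ≤ 6k - 5.
    ⟨(i + 4) / 3, by rw [Finset.mem_Icc]; omega, by omega, by omega⟩
  have h := Finset.prod_ne_zero_iff.1 (hgen k h1) (i + 1 - k) (Finset.mem_range.2 (by omega))
  convert h using 2
  rw [mul_assoc, ← pow_mul, ← zpow_natCast, ← zpow_add₀ hr]
  congr 2
  push_cast [h2]
  ring

lemma tendsto_ellipticAWIter (hp0 : p ≠ 0) (hp1 : ‖p‖ < 1) {r c : ℂ} (hr : r ≠ 0) (hc : c ≠ 0)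
    {n : ℕ} (hgen : ∀ k ∈ Finset.Icc 1 n,
      thetaFactorial (c * r ^ (2 * (k : ℤ) - 3)) (r ^ 2) p (2 * k) ≠ 0)
    {b : ℕ → ℂ} {f : ℂ → ℂ} (hf : NearlyEverywhere fun z =>
      f z = ∑ j ∈ Finset.range (n + 1), b j * quadraticBasis r p c j z) {k : ℕ} (hk : k ≤ n) :
    Tendsto (ellipticAWIter (r ^ 2) p k c f) (𝓝[≠] r) (𝓝 (b k * iterLoweringFactor r p 0 k c)) := by
  have h := ellipticAWIter_sum_quadraticBasis hp0 hp1 hr k hc hf r hr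
  refine Tendsto.congr' (h.mono fun _ hz => hz.symm) ?_
  rw [show n + 1 - k = (n - k) + 1 by omega]
  simp only [Finset.sum_range_succ', quadraticBasis_zero, zero_add, mul_one]
  have hlim := tendsto_finsetSum (Finset.range (n - k)) fun j hj =>
    (tendsto_quadraticBasis hp0 hp1 hr (c := c * (r ^ 2) ^ (3 * k))
      (mul_ne_zero hc (pow_ne_zero _ (pow_ne_zero 2 hr))) (j := j) ?_).const_mul
      (b (j + 1 + k) * iterLoweringFactor r p (j + 1) k c)
  · simpa using hlim.add_const (b k * iterLoweringFactor r p 0 k c)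
  -- At z = r the denominators are θ(cr^e) with e = 6k + 4i ± 1, within the range of the genericity
  -- condition.
  have hjk : j + k + 1 ≤ n := by have := Finset.mem_range.1 hj; omega
  refine mul_ne_zero (Finset.prod_ne_zero_iff.2 fun i hi => ?_)
    (Finset.prod_ne_zero_iff.2 fun i hi => ?_)
  · have := modTheta_ne_zero_of_generic hr hgen (i := 3 * k + 2 * i + 1)
      (by have := Finset.mem_range.1 hi; omega)
    convert this using 2
    rw [show 2 * ((3 * k + 2 * i + 1 : ℕ) : ℤ) - 1 = ((6 * k + 4 * i + 1 : ℕ) : ℤ) by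
      push_cast; ring, zpow_natCast]
    ring
  · have := modTheta_ne_zero_of_generic hr hgen (i := 3 * k + 2 * i)
      (by have := Finset.mem_range.1 hi; omega)
    convert this using 2
    rw [show 2 * ((3 * k + 2 * i : ℕ) : ℤ) - 1 = ((6 * k + 4 * i : ℕ) : ℤ) - 1 by
      push_cast; ring, zpow_sub₀ hr, zpow_natCast, zpow_one]
    field_simp
    ring

/-- Each generator is brought to the common denominator of index n by multiplying with the missing
factors, themselves an even theta function. -/
lemma exists_isEvenTheta_of_mem_abelianSpace (hp0 : p ≠ 0) (hp1 : ‖p‖ < 1) {c q : ℂ} (hc : c ≠ 0)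
    (hq : q ≠ 0) {n : ℕ} {f : ℂ → ℂ} (hf : f ∈ abelianSpace c q p n) :
    ∃ G, IsEvenTheta p n G ∧ ∀ z, thetaFactorialPair c q p n z ≠ 0 →
      f z = G z / thetaFactorialPair c q p n z := by
  induction hf using Submodule.span_induction with
  | mem f hf =>
    obtain ⟨k, hk, g, hg, rfl⟩ := hf
    obtain ⟨m, rfl⟩ := Nat.exists_eq_add_of_le hk
    refine ⟨_, hg.mul (isEvenTheta_thetaFactorialPair hp0 hp1
      (mul_ne_zero hc (pow_ne_zero k hq)) hq m), fun z hz => ?_⟩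
    rw [thetaFactorialPair_add] at hz ⊢
    rw [mul_div_mul_right _ _ (right_ne_zero_of_mul hz)]
  | zero => exact ⟨_, isEvenTheta_zero p n, fun z _ => by simp⟩
  | add f g _ _ hf hg =>
    obtain ⟨F, hF, hfF⟩ := hf
    obtain ⟨G, hG, hgG⟩ := hg
    refine ⟨_, hF.add hG, fun z hz => ?_⟩
    rw [Pi.add_apply, hfF z hz, hgG z hz, add_div]
  | smul a f _ hf =>
    obtain ⟨F, hF, hfF⟩ := hf
    refine ⟨_, hF.const_mul a, fun z hz => ?_⟩
    rw [Pi.smul_apply, hfF z hz, smul_eq_mul, mul_div_assoc]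

lemma quadraticBasis_eq_div {r c z : ℂ} {k n : ℕ} (hk : k ≤ n)
    (hz : thetaFactorialPair c (r ^ 4) p n z ≠ 0) :
    quadraticBasis r p c k z = thetaFactorialPair r (r ^ 2) p k z *
      thetaFactorialPair (c * (r ^ 4) ^ k) (r ^ 4) p (n - k) z /
        thetaFactorialPair c (r ^ 4) p n z := by
  obtain ⟨m, rfl⟩ := Nat.exists_eq_add_of_le hk
  rw [thetaFactorialPair_add] at hz
  rw [thetaFactorialPair_add, Nat.add_sub_cancel_left,
    mul_div_mul_right _ _ (right_ne_zero_of_mul hz), quadraticBasis]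

end Expansion

/-- The punctured limit encodes the removal of singularities; limits being unique, v k is determined
for k ≤ n. -/
theorem theorem2p13 (q p c r : ℂ) (hq0 : q ≠ 0) (hq1 : ‖q‖ < 1) (hp0 : p ≠ 0) (hp1 : ‖p‖ < 1)
    (hc : c ≠ 0) (hr : r ^ 4 = q) (n : ℕ)
    (hgen : ∀ k ∈ Finset.Icc 1 n, thetaFactorial q q p k ≠ 0 ∧
      thetaFactorial (c * r ^ (2 * (k : ℤ) - 3)) (r ^ 2) p (2 * k) ≠ 0)
    (f : ℂ → ℂ) (hf : f ∈ abelianSpace c q p n) :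
    ∃ v : ℕ → ℂ,
      (∀ k ≤ n, Tendsto (ellipticAWIter (r ^ 2) p k c f) (𝓝[≠] r) (𝓝 (v k))) ∧
      ∀ z : ℂ, z ≠ 0 → thetaFactorialPair c q p n z ≠ 0 →
        f z = ∑ k ∈ Finset.range (n + 1), quadraticTaylorFactor c q r p k * v k *
          (thetaFactorialPair r (r ^ 2) p k z / thetaFactorialPair c q p k z) := by
  subst hr
  have hr : r ≠ 0 := fun h => hq0 (by simp [h])
  have hgen' := fun k hk => (hgen k hk).2
  have hfac : ∀ k ≤ n,
      quadraticTaylorFactor c (r ^ 4) r p k * iterLoweringFactor r p 0 k c = 1 := fun k hk => by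
    rcases Nat.eq_zero_or_pos k with rfl | hk0
    · exact quadraticTaylorFactor_mul_iterLoweringFactor hr 0 (by simp [thetaFactorial])
        (by simp [thetaFactorial])
    · obtain ⟨h1, h2⟩ := hgen k (Finset.mem_Icc.2 ⟨hk0, hk⟩)
      exact quadraticTaylorFactor_mul_iterLoweringFactor hr k h1 h2
  obtain ⟨G, hG, hfG⟩ := exists_isEvenTheta_of_mem_abelianSpace hp0 hp1 hc hq0 hf
  have hne := nearlyEverywhere_thetaFactorialPair hp1 hc hq0 n
  set B : Fin (n + 1) → ℂ → ℂ := fun i z => thetaFactorialPair r (r ^ 2) p i z *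
    thetaFactorialPair (c * (r ^ 4) ^ (i : ℕ)) (r ^ 4) p (n - i) z with hB
  have hBeven : ∀ i, IsEvenTheta p n (B i) := fun i => by
    have := (isEvenTheta_thetaFactorialPair hp0 hp1 hr (pow_ne_zero 2 hr) i).mul
      (isEvenTheta_thetaFactorialPair hp0 hp1 (mul_ne_zero hc (pow_ne_zero i hq0)) hq0 (n - i))
    rwa [Nat.add_sub_cancel' (Nat.lt_succ_iff.1 i.2)] at this
  set ext : (Fin (n + 1) → ℂ) → ℕ → ℂ := fun b j =>
    if h : j < n + 1 then b ⟨j, h⟩ else 0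
  have hextv : ∀ b (i : Fin (n + 1)), ext b i = b i := fun b i => dif_pos i.2
  have hsum : ∀ (b : Fin (n + 1) → ℂ) (z : ℂ), thetaFactorialPair c (r ^ 4) p n z ≠ 0 →
      (∑ i, b i * B i z) / thetaFactorialPair c (r ^ 4) p n z =
        ∑ j ∈ Finset.range (n + 1), ext b j * quadraticBasis r p c j z := fun b z hz => by
    rw [Finset.sum_range, Finset.sum_div]
    refine Finset.sum_congr rfl fun i _ => ?_
    rw [hextv, quadraticBasis_eq_div (Nat.lt_succ_iff.1 i.2) hz, mul_div_assoc]
  -- The zero function also has the expansion with zero coefficients; comparing the two limits at r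
  -- gives b_i times a nonzero factor equal to 0.
  have hind : ∀ b : Fin (n + 1) → ℂ, (∀ z, z ≠ 0 → ∑ i, b i * B i z = 0) → b = 0 := by
    intro b hb
    have hb' : NearlyEverywhere fun z => (fun _ => (0 : ℂ)) z =
        ∑ j ∈ Finset.range (n + 1), ext b j * quadraticBasis r p c j z :=
      hne.mono fun z hz hz' => by rw [← hsum b z hz', hb z hz, zero_div]
    ext i
    have hi := Nat.lt_succ_iff.1 i.2
    have h1 := tendsto_ellipticAWIter hp0 hp1 hr hc hgen' hb' hi
    have h2 : Tendsto (ellipticAWIter (r ^ 2) p i c fun _ => 0) (𝓝[≠] r) (𝓝 0) := by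
      have h0 : NearlyEverywhere fun z => (fun _ => (0 : ℂ)) z =
          ∑ j ∈ Finset.range (n + 1), (0 : ℕ → ℂ) j * quadraticBasis r p c j z :=
        .of_forall fun z _ => by simp
      simpa using tendsto_ellipticAWIter hp0 hp1 hr hc hgen' h0 hi
    have h3 := tendsto_nhds_unique h1 h2
    rw [hextv] at h3
    exact (mul_eq_zero.1 h3).resolve_right (right_ne_zero_of_mul_eq_one (hfac i hi))
  obtain ⟨b, hb⟩ := IsEvenTheta.exists_eq_sum hp0 hp1 hBeven hind hG
  have hexp : ∀ z : ℂ, z ≠ 0 → thetaFactorialPair c (r ^ 4) p n z ≠ 0 →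
      f z = ∑ j ∈ Finset.range (n + 1), ext b j * quadraticBasis r p c j z := fun z hz hz' => by
    rw [hfG z hz', hb z hz, hsum b z hz']
  refine ⟨fun k => ext b k * iterLoweringFactor r p 0 k c, fun k hk =>
    tendsto_ellipticAWIter hp0 hp1 hr hc hgen' (hne.mono hexp) hk, fun z hz hz' => ?_⟩
  rw [hexp z hz hz']
  refine Finset.sum_congr rfl fun k hk => ?_
  rw [mul_left_comm, hfac k (Nat.lt_succ_iff.1 (Finset.mem_range.1 hk)), mul_one, quadraticBasis]
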